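/- Let $\Sigma_{1,1}$ be the once-punctured torus and let $(a,b)$ be a pair of free generators of its fundamental group (at any base point), which is a free group of rank $2$. A curve means a free homotopy class of oriented closed curves on $\Sigma_{1,1}$; no restriction is put on its self-intersection number, and the trivial and peripheral classes are included. A curve is primitive if it is not a proper power (the $k$-th power with $k\ge 2$) of a curve. A word $x_1\cdots x_n$ in the letters $a,b,a^{-1},b^{-1}$ is reduced if $x_{i+1}\neq x_i^{-1}$ for $1\le i<n$ and $x_1\neq x_n^{-1}$. A curve $\gamma$ has word length $\ell_\omega(\gamma)=n$ if it is represented by a reduced word of $n$ letters. Let $\mathcal{C}^*$ be the set of all curves on $\Sigma_{1,1}$ and $\mathcal{PC}^*\subset\mathcal{C}^*$ the subset of primitive ones. Then, as $L\to\infty$ through the positive integers, $$|\{\gamma\in\mathcal{PC}^* : \ell_\omega(\gamma)=L\}|\sim\frac{3^L}{L},\qquad |\{\gamma\in\mathcal{PC}^* : \ell_\omega(\gamma)\le L\}|\sim\frac32\cdot\frac{3^L}{L},$$ and likewise $$|\{\gamma\in\mathcal{C}^* : \ell_\omega(\gamma)=L\}|\sim\frac{3^L}{L},\qquad |\{\gamma\in\mathcal{C}^*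 : \ell_\omega(\gamma)\le L\}|\sim\frac32\cdot\frac{3^L}{L},$$ where $f(L)\sim g(L)$ means $f(L)/g(L)\to 1$. -/

import Mathlib

open Filter

/-- The once-punctured torus `Σ_{1,1}`: the torus `(ℝ/ℤ) × (ℝ/ℤ)` with one point removed. -/
abbrev OncePuncturedTorus : Type :=
  {p : UnitAddCircle × UnitAddCircle // p ≠ 0}

/-- Free homotopy of (oriented, continuous) closed curves in a space `X`, a closed curve being a
continuous map from the circle `ℝ/ℤ` to `X`. -/
def freeHomotopySetoid (X : Type*) [TopologicalSpace X] : Setoid C(UnitAddCircle, X) :=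
  ⟨ContinuousMap.Homotopic, ContinuousMap.Homotopic.equivalence⟩

/-- The set of all free homotopy classes of oriented closed curves in `X`. -/
def FreeHomotopyClass (X : Type*) [TopologicalSpace X] : Type _ :=
  Quotient (freeHomotopySetoid X)

namespace FreeHomotopyClass

variable {X : Type*} [TopologicalSpace X]

/-- The free homotopy class of a closed curve. -/
def mk (c : C(UnitAddCircle, X)) : FreeHomotopyClass X :=
  Quotient.mk (freeHomotopySetoid X) c

/-- The `k`-fold covering `t ↦ k t` of the circle by itself. -/
def circlePow (k : ℕ) : C(UnitAddCircle, UnitAddCircle) :=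
  ⟨fun t => k • t, continuous_nsmul k⟩

/-- The `k`-th power of a free homotopy class: run `k` times along a representing curve. -/
def pow (γ : FreeHomotopyClass X) (k : ℕ) : FreeHomotopyClass X :=
  Quotient.map' (fun c => c.comp (circlePow k))
    (fun _ _ h => ContinuousMap.Homotopic.comp h (ContinuousMap.Homotopic.refl _)) γ

/-- A class is primitive if it is not a proper power of a class. -/
def IsPrimitive (γ : FreeHomotopyClass X) : Prop :=
  ¬ ∃ (δ : FreeHomotopyClass X) (k : ℕ), 2 ≤ k ∧ γ = δ.pow k

/-- The free homotopy class `γ` is represented by the element `g` of the fundamental group: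
some loop `p` at `x` has class `g` in `π₁(X, x)` and, viewed as a closed curve `c` on the circle
(forgetting the base point), belongs to `γ`. -/
def IsRepresentedBy (γ : FreeHomotopyClass X) {x : X} (g : FundamentalGroup X x) : Prop :=
  ∃ (p : Path x x) (c : C(UnitAddCircle, X)),
    (∀ t : unitInterval, c ((t : ℝ) : UnitAddCircle) = p t) ∧
      FundamentalGroup.fromPath (Path.Homotopic.Quotient.mk p) = g ∧ mk c = γ

/-- `γ` has word length `n` with respect to the pair `B = (a, b)` of free generators of `π₁(X, x)`:
it is represented by a (cyclically) reduced word of `n` letters in `a, b, a⁻¹, b⁻¹`.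
The letter `(i, true)` stands for the `i`-th generator and `(i, false)` for its inverse. -/
def HasWordLength {x : X} (B : FreeGroupBasis (Fin 2) (FundamentalGroup X x))
    (γ : FreeHomotopyClass X) (n : ℕ) : Prop :=
  ∃ w : List (Fin 2 × Bool), FreeGroup.IsCyclicallyReduced w ∧ w.length = n ∧
    γ.IsRepresentedBy
      (w.map fun l => if l.2 then B l.1 else (B l.1)⁻¹).prod

end FreeHomotopyClass

/-! Free homotopy classes of closed curves correspond to conjugacy classes of the fundamental group
(`IsRepresentedBy.eq_of_isConj`, `IsRepresentedBy.isConj`). In a free group, conjugate cyclically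
reduced words are rotations of each other. So curves of word length `L` are cyclic words of length
`L` (`ofWord_eq_ofWord_iff`), and the punctured torus enters only through its free basis of rank 2.

There are `3 ^ L + O(1)` cyclically reduced words. Such a word has `L` distinct rotations unless it
has a period at most `L / 2`, and at most `L * 2 ^ L` words have one. A proper power gives such a
periodic word (`IsCyclicallyReduced.exists_rotate_eq`), so both counts, primitive or not, satisfy `L
* count = 3 ^ L + O(L ^ 2 * 2 ^ L)`. For lengths at most `L`, compare with a geometric series: `3 /
2 = 1 / (1 - 1 / 3)`. -/

namespace FreeGroup

/-! ### Conjugacy and proper powers in free groups -/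

variable {α : Type*}

theorem isCyclicallyReduced_iff_chain {w : List (α × Bool)} :
    IsCyclicallyReduced w ↔
      Cycle.Chain (fun a b : α × Bool => a.1 = b.1 → a.2 = b.2) (w : Cycle _) := by
  cases w with
  | nil => simp
  | cons a l =>
    rw [Cycle.chain_coe_cons, ← List.cons_append, List.isChain_append, isCyclicallyReduced_iff,
      IsReduced]
    simp

theorem IsCyclicallyReduced.isRotated {v w : List (α × Bool)} (h : IsCyclicallyReduced v)
    (hvw : v ~r w) : IsCyclicallyReduced w := by
  rw [isCyclicallyReduced_iff_chain] at h ⊢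
  rwa [← Cycle.coe_eq_coe.2 hvw]

/-- The reduced form of a conjugate of the cyclically reduced word `w`. -/
def IsConjForm (w : List (α × Bool)) (g : FreeGroup α) : Prop :=
  ∃ u v : List (α × Bool), v ~r w ∧ IsReduced (u ++ v ++ invRev u) ∧
    g = mk (u ++ v ++ invRev u)

theorem mk_cons (a : α × Bool) (l : List (α × Bool)) : mk (a :: l) = mk [a] * mk l := by
  rw [mul_mk, List.singleton_append]

theorem mk_singleton_not (a : α × Bool) : mk [(a.1, !a.2)] = (mk [a])⁻¹ := by
  simp [inv_mk, invRev]

theorem eq_not_of_not_imp {a b : α × Bool} (h : ¬ (a.1 = b.1 → a.2 = b.2)) :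
    b = (a.1, !a.2) := by
  push Not at h
  ext
  · exact h.1.symm
  · simpa using (Bool.not_eq_eq_eq_not.2 (Bool.eq_not.2 h.2)).symm

theorem IsReduced.cons_append_not {a : α × Bool} {l : List (α × Bool)} (hl : IsReduced l)
    (hne : l ≠ []) (hh : ∀ b ∈ l.head?, a.1 = b.1 → a.2 = b.2)
    (ht : ∀ b ∈ l.getLast?, b.1 = a.1 → b.2 = !a.2) :
    IsReduced (a :: l ++ [(a.1, !a.2)]) := by
  rw [IsReduced, List.isChain_append, List.isChain_cons]
  refine ⟨⟨hh, hl⟩, List.isChain_singleton _, fun b hb c hc => ?_⟩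
  obtain ⟨x, l, rfl⟩ := List.exists_cons_of_ne_nil hne
  simp only [List.head?_cons, Option.mem_def, Option.some.injEq] at hc
  subst hc
  exact ht b (by simpa using hb)

/-- Conjugating by one letter prolongs `u` or cancels its first letter. When `u` is empty, a
cancellation at either end of `v` merely rotates `v`. -/
theorem IsConjForm.conj_singleton {w : List (α × Bool)} (hw : IsCyclicallyReduced w)
    {g : FreeGroup α} (h : IsConjForm w g) (a : α × Bool) :
    IsConjForm w (mk [a] * g * (mk [a])⁻¹) := by
  obtain ⟨u, v, hv, hr, rfl⟩ := h
  have hcv := hw.isRotated hv.symm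
  cases u with
  | cons b u =>
    by_cases hab : a.1 = b.1 → a.2 = b.2
    · refine ⟨a :: b :: u, v, hv, ?_, ?_⟩
      · have h1 := hr.cons_append_not (a := a) (by simp) (by simpa using hab) (by
          simp [invRev]; grind)
        simpa [invRev] using h1
      · rw [← mk_singleton_not, mul_mk, mul_mk]; simp [invRev]
    · have := eq_not_of_not_imp hab
      subst this
      refine ⟨u, v, hv, hr.infix ⟨[(a.1, !a.2)], [a], by simp [invRev]⟩, ?_⟩
      simp only [← mul_mk, ← List.singleton_append (l := u), mk_singleton_not, invRev_append,
        ← inv_mk]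
      group
  | nil =>
    simp only [List.nil_append, invRev_empty, List.append_nil] at hr ⊢
    by_cases hv0 : v = []
    · subst hv0
      exact ⟨[], [], hv, by simp, by
        simp only [List.nil_append, invRev_empty, ← one_eq_mk, mul_one, mul_inv_cancel]⟩
    by_cases hh : ∀ b ∈ v.head?, a.1 = b.1 → a.2 = b.2
    · by_cases ht : ∀ b ∈ v.getLast?, b.1 = a.1 → b.2 = !a.2
      · refine ⟨[a], v, hv, ?_, ?_⟩
        · simpa [invRev] using hr.cons_append_not hv0 hh ht
        · rw [← mk_singleton_not, mul_mk, mul_mk]; simp [invRev]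
      · push Not at ht
        obtain ⟨b, hb, hb1, hb2⟩ := ht
        have hba : b = a := Prod.ext hb1 (by simpa using hb2)
        subst hba
        obtain ⟨t, rfl⟩ : ∃ t, v = t ++ [b] := ⟨_, (List.dropLast_append_getLast? b hb).symm⟩
        have hrot : t ++ [b] ~r b :: t := List.isRotated_concat b t
        refine ⟨[], b :: t, hrot.symm.trans hv, ?_, ?_⟩
        · simpa using (hcv.isRotated hrot).isReduced
        · rw [List.nil_append, invRev_empty, List.append_nil, mk_cons b t, ← mul_mk]
          group
    · push Not at hh
      obtain ⟨b, hb, hab⟩ := hh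
      have := eq_not_of_not_imp (a := a) (b := b) (by tauto)
      obtain ⟨t, rfl⟩ : ∃ t, v = b :: t := ⟨_, List.eq_cons_of_mem_head? hb⟩
      have hrot : t ++ [b] ~r b :: t := List.isRotated_concat b t
      refine ⟨[], t ++ [b], hrot.trans hv, ?_, ?_⟩
      · simpa using (hcv.isRotated hrot.symm).isReduced
      · subst this
        rw [List.nil_append, invRev_empty, List.append_nil, mk_cons _ t, ← mul_mk,
          mk_singleton_not]
        group

theorem IsConjForm.conj {w : List (α × Bool)} (hw : IsCyclicallyReduced w)
    (l : List (α × Bool)) : IsConjForm w (mk l * mk w * (mk l)⁻¹) := by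
  induction l with
  | nil => exact ⟨[], w, .refl _, by simpa using hw.isReduced, by simp [← one_eq_mk]⟩
  | cons a l ih =>
    have := ih.conj_singleton hw a
    rw [mk_cons, mul_inv_rev]
    simpa only [mul_assoc] using this

theorem IsReduced.eq_of_mk_eq {v w : List (α × Bool)} (hv : IsReduced v) (hw : IsReduced w)
    (h : mk v = mk w) : v = w := by
  classical
  rw [← hv.reduce_eq, ← hw.reduce_eq]
  exact reduce.sound h

/-- Conjugate cyclically reduced words are cyclic permutations of each other. -/
theorem IsCyclicallyReduced.isRotated_of_isConj {v w : List (α × Bool)}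
    (hv : IsCyclicallyReduced v) (hw : IsCyclicallyReduced w) (h : IsConj (mk w) (mk v)) :
    v ~r w := by
  obtain ⟨c, hc⟩ := isConj_iff.1 h
  obtain ⟨l, rfl⟩ := Quot.exists_rep c
  obtain ⟨u, v', hv', hr, he⟩ := IsConjForm.conj hw l
  have hvu : v = u ++ v' ++ invRev u := hv.isReduced.eq_of_mk_eq hr (hc.symm.trans he)
  -- A nonempty `u` would make `v` start with a letter and end with its inverse.
  cases u with
  | nil => simpa [hvu] using hv'
  | cons b u =>
    have h2 := hv.2 (b.1, !b.2) 
      (by simp only [hvu, invRev, List.map_cons, List.reverse_cons, ← List.append_assoc,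
        List.getLast?_concat, Option.mem_def]) b (by simp [hvu]) rfl
    simp at h2

theorem mk_flatten_replicate (w : List (α × Bool)) (k : ℕ) :
    mk (List.replicate k w).flatten = mk w ^ k := by
  induction k with
  | zero => simp [one_eq_mk]
  | succ k ih => rw [List.replicate_succ, List.flatten_cons, ← mul_mk, ih, pow_succ']

/-- Every element of a free group is conjugate to one given by a cyclically reduced word. -/
theorem exists_isCyclicallyReduced_isConj (g : FreeGroup α) :
    ∃ v, IsCyclicallyReduced v ∧ IsConj (mk v) g := by
  classical
  refine ⟨reduceCyclically g.toWord, reduceCyclically.isCyclicallyReduced isReduced_toWord,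
    isConj_iff.2 ⟨mk (reduceCyclically.conjugator g.toWord), ?_⟩⟩
  rw [inv_mk, mul_mk, mul_mk, reduceCyclically.conj_conjugator_reduceCyclically, mk_toWord]

/-- A cyclically reduced word representing a proper power has a period dividing its length at
least twice. -/
theorem IsCyclicallyReduced.exists_rotate_eq {w : List (α × Bool)} (hw : IsCyclicallyReduced w)
    (hne : w ≠ []) {g : FreeGroup α} {k : ℕ} (hk : 2 ≤ k) (h : mk w = g ^ k) :
    ∃ m, 0 < m ∧ 2 * m ≤ w.length ∧ w.rotate m = w := by
  obtain ⟨v, hv, hc⟩ := exists_isCyclicallyReduced_isConj g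
  obtain ⟨c, hc⟩ := isConj_iff.1 hc
  -- The power `v ^ k` of a cyclically reduced word is cyclically reduced without cancellation, so
  -- `w` is a rotation of it and inherits the period `v.length`.
  have hrot : w ~r (List.replicate k v).flatten := by
    refine hw.isRotated_of_isConj (hv.flatten_replicate k) (isConj_iff.2 ⟨c, ?_⟩)
    rw [mk_flatten_replicate, h, ← hc, conj_pow]
  obtain ⟨n, rfl⟩ := hrot.symm
  have hper : (List.replicate k v).flatten.rotate v.length = (List.replicate k v).flatten := by
    obtain ⟨k, rfl⟩ : ∃ j, k = j + 1 := ⟨k - 1, by omega⟩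
    nth_rw 1 [List.replicate_succ]
    rw [List.flatten_cons, List.rotate_append_length_eq, List.replicate_succ', List.flatten_concat]
  have hv0 : v ≠ [] := by rintro rfl; simp at hne
  refine ⟨v.length, List.length_pos_iff.2 hv0, ?_, ?_⟩
  · rw [List.length_rotate, List.length_flatten]
    simpa using Nat.mul_le_mul_right _ hk
  · rw [List.rotate_rotate, add_comm, ← List.rotate_rotate, hper]

end FreeGroup

/-! ### Counting cyclically reduced words and cyclic words -/

namespace FreeGroup

/-- The words `l` of length `n` in two generators and their inverses such that `s :: l` is reduced
and ends in the letter `t`. -/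
def wordsBetween : ℕ → Fin 2 × Bool → Fin 2 × Bool → Finset (List (Fin 2 × Bool))
  | 0, s, t => if s = t then {[]} else ∅
  | n + 1, s, t => (Finset.univ.erase (s.1, !s.2)).biUnion fun b =>
      (wordsBetween n b t).map ⟨List.cons b, List.cons_injective⟩

theorem mem_wordsBetween {n : ℕ} {s t : Fin 2 × Bool} {l : List (Fin 2 × Bool)} :
    l ∈ wordsBetween n s t ↔
      l.length = n ∧ IsReduced (s :: l) ∧ (s :: l).getLast (List.cons_ne_nil s l) = t := by
  induction n generalizing s l with
  | zero =>
    rw [wordsBetween]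
    split_ifs with h <;> cases l <;> simp [h]
  | succ n ih =>
    cases l with
    | nil => simp [wordsBetween]
    | cons b l =>
      have hb : b ≠ (s.1, !s.2) ↔ (s.1 = b.1 → s.2 = b.2) := by
        rcases s with ⟨s, s'⟩
        rcases b with ⟨b, b'⟩
        cases s' <;> cases b' <;> simp [eq_comm]
      simp [wordsBetween, ih, hb, isReduced_cons_cons]
      tauto

theorem card_wordsBetween_succ (n : ℕ) (s t : Fin 2 × Bool) :
    (wordsBetween (n + 1) s t).card + (wordsBetween n (s.1, !s.2) t).card =
      ∑ b, (wordsBetween n b t).card := by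
  rw [wordsBetween, Finset.card_biUnion, ← Finset.sum_erase_add _ _ (Finset.mem_univ (s.1, !s.2))]
  · simp
  · intro a _ b _ hab
    rw [Function.onFun, Finset.disjoint_left]
    simp only [Finset.mem_map, Function.Embedding.coeFn_mk, not_exists, not_and]
    rintro _ ⟨x, _, rfl⟩ y _ h
    exact hab (List.cons.inj h).1.symm

theorem sum_card_wordsBetween (n : ℕ) (t : Fin 2 × Bool) :
    ∑ b, (wordsBetween n b t).card = 3 ^ n := by
  induction n with
  | zero => simp [wordsBetween, apply_ite Finset.card]
  | succ n ih =>
    have h : ∑ s, ((wordsBetween (n + 1) s t).card + (wordsBetween n (s.1, !s.2) t).card) =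
        4 * 3 ^ n := by
      simp [card_wordsBetween_succ, ih]
    have h2 : ∑ s : Fin 2 × Bool, (wordsBetween n (s.1, !s.2) t).card = 3 ^ n := by
      rw [← ih]
      exact Fintype.sum_equiv ((Equiv.refl _).prodCongr Equiv.boolNot) _ _ fun _ => rfl
    rw [Finset.sum_add_distrib, h2] at h
    rw [pow_succ]
    omega

/-- The count at `n + 1` is `3 ^ n` minus the count at `n` from the inverse letter, so the deviation
from `3 ^ n / 4` only changes sign. At `n = 0` it is `3 / 4` or `-1 / 4`. -/
theorem abs_card_wordsBetween_sub_le (n : ℕ) (s t : Fin 2 × Bool) :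
    |((wordsBetween n s t).card : ℝ) - 3 ^ n / 4| ≤ 3 / 4 := by
  induction n generalizing s with
  | zero =>
    rw [wordsBetween]
    split_ifs <;> norm_num [abs_le]
  | succ n ih =>
    have h : ((wordsBetween (n + 1) s t).card : ℝ) + (wordsBetween n (s.1, !s.2) t).card = 3 ^ n := by
      exact_mod_cast (card_wordsBetween_succ n s t).trans (sum_card_wordsBetween n t)
    rw [eq_sub_of_add_eq h, ← abs_neg]
    convert ih (s.1, !s.2) using 2
    ring

/-- The cyclically reduced words of length `L` in two generators and their inverses. -/
def cycWords (L : ℕ) : Finset (List (Fin 2 × Bool)) :=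
  Finset.univ.biUnion fun s => wordsBetween L s s

/-- A nonempty word is cyclically reduced exactly when it stays reduced after prepending its own
last letter. -/
theorem mem_cycWords {L : ℕ} {w : List (Fin 2 × Bool)} :
    w ∈ cycWords L ↔ w.length = L ∧ IsCyclicallyReduced w := by
  simp only [cycWords, Finset.mem_biUnion, Finset.mem_univ, true_and, mem_wordsBetween]
  rcases eq_or_ne w [] with rfl | hw
  · simp
  · rw [isCyclicallyReduced_iff_chain, Cycle.chain_ne_nil _ hw]
    constructor
    · rintro ⟨s, h1, h2, h3⟩
      rw [List.getLast_cons hw] at h3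
      exact ⟨h1, h3 ▸ h2⟩
    · rintro ⟨h1, h2⟩
      exact ⟨_, h1, h2, List.getLast_cons hw⟩

theorem abs_card_cycWords_sub_le {L : ℕ} (hL : 0 < L) :
    |((cycWords L).card : ℝ) - 3 ^ L| ≤ 3 := by
  have h : (cycWords L).card = ∑ s, (wordsBetween L s s).card := by
    refine Finset.card_biUnion fun a _ b _ hab => Finset.disjoint_left.2 fun l ha hb => hab ?_
    rw [mem_wordsBetween] at ha hb
    have hl : l ≠ [] := List.length_pos_iff.1 (by omega)
    rw [← ha.2.2, ← hb.2.2, List.getLast_cons hl, List.getLast_cons hl]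
  have h2 : ((cycWords L).card : ℝ) - 3 ^ L =
      ∑ s : Fin 2 × Bool, (((wordsBetween L s s).card : ℝ) - 3 ^ L / 4) := by
    rw [h, Finset.sum_sub_distrib]
    simp
    ring
  rw [h2]
  refine (Finset.abs_sum_le_sum_abs _ _).trans
    ((Finset.sum_le_sum fun s _ => abs_card_wordsBetween_sub_le L s s).trans ?_)
  norm_num

/-- The cyclic words given by cyclically reduced words of length `L`. -/
def cycClasses (L : ℕ) : Finset (Cycle (Fin 2 × Bool)) :=
  (cycWords L).image (↑)

theorem card_cycWords_le {L : ℕ} (hL : 0 < L) :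
    (cycWords L).card ≤ L * (cycClasses L).card := by
  refine Finset.card_le_mul_card_image _ _ fun c hc => ?_
  obtain ⟨w, hw, rfl⟩ := Finset.mem_image.1 hc
  have hwl := (mem_cycWords.1 hw).1
  calc _ ≤ ((Finset.range L).image w.rotate).card := Finset.card_le_card fun v hv => by
        obtain ⟨n, hn⟩ := (Cycle.coe_eq_coe.1 (Finset.mem_filter.1 hv).2).symm
        refine Finset.mem_image.2 ⟨n % L, Finset.mem_range.2 (Nat.mod_lt _ hL), ?_⟩
        rw [← hwl, List.rotate_mod, hn]
    _ ≤ _ := Finset.card_image_le.trans (Finset.card_range L).le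

/-- The cyclically reduced words of length `L` with a period of at most `L / 2`. -/
def periodicWords (L : ℕ) : Finset (List (Fin 2 × Bool)) :=
  (Finset.Icc 1 (L / 2)).biUnion fun m => {w ∈ cycWords L | w.rotate m = w}

theorem mem_periodicWords {L : ℕ} {w : List (Fin 2 × Bool)} :
    w ∈ periodicWords L ↔ w ∈ cycWords L ∧ ∃ m ∈ Finset.Icc 1 (L / 2), w.rotate m = w := by
  simp only [periodicWords, Finset.mem_biUnion, Finset.mem_filter]
  tauto

/-- A class of non-periodic words contains `L` distinct rotations; the remaining classes are at most
as many as the periodic words. -/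
theorem mul_card_cycClasses_le (L : ℕ) :
    L * (cycClasses L).card ≤ (cycWords L).card + L * (periodicWords L).card := by
  set N := cycWords L \ periodicWords L with hN
  have hsub : cycClasses L ⊆ N.image (↑) ∪ (periodicWords L).image (↑) := by
    rw [← Finset.image_union]
    exact Finset.image_subset_image fun w hw => by simp [hN, hw]
  have hcard : L * (N.image ((↑) : List (Fin 2 × Bool) → Cycle (Fin 2 × Bool))).card ≤ N.card := by
    refine Finset.mul_card_image_le_card _ _ fun c hc => ?_
    obtain ⟨w, hw, rfl⟩ := Finset.mem_image.1 hc
    obtain ⟨hw, hper⟩ := Finset.mem_sdiff.1 hw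
    obtain ⟨hl, hcr⟩ := mem_cycWords.1 hw
    have hfix : ∀ m ∈ Finset.Icc 1 (L / 2), w.rotate m ≠ w := fun m hm h =>
      hper (mem_periodicWords.2 ⟨hw, m, hm, h⟩)
    have hfix' : ∀ m, 0 < m → m < L → w.rotate m ≠ w := fun m h0 h1 h => by
      by_cases h2 : m ≤ L / 2
      · exact hfix m (Finset.mem_Icc.2 ⟨h0, h2⟩) h
      -- Rotation by `m` and by `L - m` are mutually inverse, so the smaller one may be used.
      · refine hfix (L - m) (Finset.mem_Icc.2 ⟨by omega, by omega⟩) ?_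
        nth_rw 1 [← h]
        rw [List.rotate_rotate, Nat.add_sub_cancel' h1.le, ← hl, List.rotate_length]
    have hlt : ∀ i j, i < j → j < L → w.rotate i ≠ w.rotate j := fun i j hij hj h => by
      refine hfix' (j - i) (by omega) (by omega) (List.rotate_injective i ?_)
      simp only [List.rotate_rotate, Nat.sub_add_cancel hij.le, h]
    have hinj : Set.InjOn w.rotate (Finset.range L : Set ℕ) := fun i hi j hj h => by
      simp only [Finset.coe_range, Set.mem_Iio] at hi hj
      rcases lt_trichotomy i j with hij | hij | hij
      · exact (hlt i j hij hj h).elim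
      · exact hij
      · exact (hlt j i hij hi h.symm).elim
    rw [← Finset.card_range L, ← Finset.card_image_of_injOn hinj]
    refine Finset.card_le_card fun v hv => ?_
    obtain ⟨n, -, rfl⟩ := Finset.mem_image.1 hv
    have hrot : w.rotate n ~r w := List.IsRotated.forall w n
    refine Finset.mem_filter.2 ⟨Finset.mem_sdiff.2 ⟨?_, fun h => ?_⟩, Cycle.coe_eq_coe.2 hrot⟩
    · exact mem_cycWords.2 ⟨by simpa using hl, hcr.isRotated hrot.symm⟩
    · obtain ⟨-, m, hm, h⟩ := mem_periodicWords.1 h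
      refine hfix m hm (List.rotate_injective n ?_)
      simpa only [List.rotate_rotate, add_comm] using h
  calc L * (cycClasses L).card
      ≤ L * ((N.image Cycle.ofList).card + ((periodicWords L).image Cycle.ofList).card) :=
        Nat.mul_le_mul_left _ ((Finset.card_le_card hsub).trans (Finset.card_union_le _ _))
    _ ≤ _ := by
        rw [mul_add]
        exact add_le_add (hcard.trans (Finset.card_le_card Finset.sdiff_subset))
          (Nat.mul_le_mul_left _ Finset.card_image_le)

theorem getElem?_add_of_rotate_eq {α : Type*} {w : List α} {m i : ℕ} (h : w.rotate m = w)
    (hi : i + m < w.length) : w[i + m]? = w[i]? := by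
  nth_rw 2 [← h]
  rw [List.getElem?_rotate (by omega), Nat.mod_eq_of_lt hi]

/-- A word of period `m` is determined by its first `m` letters, leaving at most `4 ^ m ≤ 2 ^ L`
choices for each `m ≤ L / 2`. -/
theorem card_periodicWords_le (L : ℕ) : (periodicWords L).card ≤ L * 2 ^ L := by
  refine (Finset.card_biUnion_le_card_mul _ _ (2 ^ L) ?_).trans
    (Nat.mul_le_mul_right _ (by simpa using Nat.div_le_self L 2))
  intro m hm
  rw [Finset.mem_Icc] at hm
  calc _ ≤ (Finset.univ : Finset (Fin m → Fin 2 × Bool)).card := by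
        -- The default letter is never read, because `m ≤ L / 2` keeps the index below `L`.
        refine Finset.card_le_card_of_injOn (fun w i => w[(i : ℕ)]?.getD (0, true))
          (fun _ _ => Finset.mem_coe.2 (Finset.mem_univ _)) fun v hv w hw hvw => ?_
        simp only [Finset.coe_filter, Set.mem_ofPred_eq, mem_cycWords] at hv hw
        obtain ⟨⟨hvl, -⟩, hv⟩ := hv
        obtain ⟨⟨hwl, -⟩, hw⟩ := hw
        refine List.ext_getElem? fun i => ?_
        induction i using Nat.strong_induction_on with
        | _ i ih =>
          rcases le_or_gt L i with hi | hi
          · rw [List.getElem?_eq_none (by omega), List.getElem?_eq_none (by omega)]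
          rcases lt_or_ge i m with him | him
          · have h := congrFun hvw ⟨i, him⟩
            simp only [List.getElem?_eq_getElem (hvl.symm ▸ hi : i < v.length),
              List.getElem?_eq_getElem (hwl.symm ▸ hi : i < w.length), Option.getD_some] at h ⊢
            rw [h]
          · obtain ⟨j, rfl⟩ := Nat.exists_eq_add_of_le' him
            rw [getElem?_add_of_rotate_eq hv (by omega), getElem?_add_of_rotate_eq hw (by omega)]
            exact ih j (by omega)
    _ = 2 ^ (2 * m) := by simp [pow_mul]
    _ ≤ 2 ^ L := Nat.pow_le_pow_right two_pos (by omega)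

end FreeGroup

/-! ### Free homotopy classes and conjugacy in the fundamental group -/

open scoped unitInterval CategoryTheory

namespace FreeHomotopyClass

variable {X : Type*} [TopologicalSpace X] {x : X}

/-- The loop running once along the circle. -/
noncomputable def circleLoop : Path (0 : UnitAddCircle) 0 where
  toFun t := ((t : ℝ) : UnitAddCircle)
  continuous_toFun := (AddCircle.continuous_mk' 1).comp continuous_subtype_val
  source' := by simp
  target' := by simp

theorem circleLoop_surjective : Function.Surjective circleLoop := by
  intro θ
  obtain ⟨y, hy, rfl⟩ := (AddCircle.coe_image_Ico_eq (1 : ℝ) 0).symm ▸ Set.mem_univ θ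
  rw [zero_add] at hy
  exact ⟨⟨y, hy.1, hy.2.le⟩, rfl⟩

theorem apply_eq_of_circleLoop_eq {Y : Type*} {f : I → Y} (hf : f 0 = f 1) {s t : I}
    (h : circleLoop s = circleLoop t) : f s = f t := by
  obtain ⟨n, hn⟩ := AddCircle.coe_eq_zero_iff (1 : ℝ) (x := (s : ℝ) - t) |>.1 (by
    rw [AddCircle.coe_sub, sub_eq_zero]
    exact h)
  simp only [zsmul_eq_mul, mul_one] at hn
  have h1 : (n : ℝ) ≤ 1 := by linarith [s.2.2, t.2.1]
  have h2 : (-1 : ℝ) ≤ n := by linarith [t.2.2, s.2.1]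
  have h3 : n ≤ 1 := by exact_mod_cast h1
  have h4 : -1 ≤ n := by exact_mod_cast h2
  interval_cases n
  · have hs : s = 0 := Subtype.ext (by push_cast at hn ⊢; linarith [s.2.1, t.2.2])
    have ht : t = 1 := Subtype.ext (by push_cast at hn ⊢; linarith [s.2.1, t.2.2])
    rw [hs, ht, hf]
  · have hs : s = t := Subtype.ext (by push_cast at hn; linarith)
    rw [hs]
  · have hs : s = 1 := Subtype.ext (by push_cast at hn ⊢; linarith [s.2.2, t.2.1])
    have ht : t = 0 := Subtype.ext (by push_cast at hn ⊢; linarith [s.2.2, t.2.1])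
    rw [hs, ht, hf]

/-- Every loop factors through the circle. -/
theorem exists_circleMap (p : Path x x) :
    ∃ c : C(UnitAddCircle, X), ∀ t : I, c ((t : ℝ) : UnitAddCircle) = p t := by
  have hq : Topology.IsQuotientMap (circleLoop : C(I, UnitAddCircle)) :=
    .of_surjective_continuous circleLoop_surjective circleLoop.continuous
  have hp : Function.FactorsThrough (p : C(I, X)) (circleLoop : C(I, UnitAddCircle)) :=
    fun s t h => apply_eq_of_circleLoop_eq (by simp) h
  exact ⟨hq.lift (p : C(I, X)) hp, fun t => DFunLike.congr_fun (hq.lift_comp (p : C(I, X)) hp) t⟩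

/-- Path homotopic loops give freely homotopic closed curves. -/
theorem homotopic_of_path_homotopic {p q : Path x x} (h : p.Homotopic q)
    {c d : C(UnitAddCircle, X)} (hc : ∀ t : I, c ((t : ℝ) : UnitAddCircle) = p t)
    (hd : ∀ t : I, d ((t : ℝ) : UnitAddCircle) = q t) : c.Homotopic d := by
  obtain ⟨F⟩ := h
  -- The homotopy fixes endpoints, so it takes equal values on both ends of each slice and descends
  -- along the quotient map `Q`.
  set Q : C(I × I, I × UnitAddCircle) := (ContinuousMap.id I).prodMap (circleLoop : C(I, _))
  have hsurj : Function.Surjective Q := Function.surjective_id.prodMap circleLoop_surjective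
  have hq : Topology.IsQuotientMap Q := .of_surjective_continuous hsurj Q.continuous
  have hF : Function.FactorsThrough (F.toContinuousMap : C(I × I, X)) Q := by
    rintro ⟨s, t⟩ ⟨s', t'⟩ h
    obtain ⟨h1, h2⟩ := Prod.mk.inj h
    obtain rfl : s = s' := h1
    exact apply_eq_of_circleLoop_eq (f := fun t => F (s, t)) (by simp) h2
  have hlift : ∀ s t : I, hq.lift F.toContinuousMap hF (s, ((t : ℝ) : UnitAddCircle)) = F (s, t) :=
    fun s t => DFunLike.congr_fun (hq.lift_comp F.toContinuousMap hF) (s, t)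
  refine ⟨⟨hq.lift F.toContinuousMap hF, fun θ => ?_, fun θ => ?_⟩⟩ <;>
    obtain ⟨t, rfl⟩ := circleLoop_surjective θ
  · exact (hlift 0 t).trans ((F.apply_zero t).trans (hc t).symm)
  · exact (hlift 1 t).trans ((F.apply_one t).trans (hd t).symm)

theorem exists_isRepresentedBy (g : FundamentalGroup X x) :
    ∃ γ : FreeHomotopyClass X, γ.IsRepresentedBy g := by
  obtain ⟨p, rfl⟩ := Path.Homotopic.Quotient.mk_surjective g
  obtain ⟨c, hc⟩ := exists_circleMap p
  exact ⟨mk c, p, c, hc, rfl, rfl⟩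

theorem IsRepresentedBy.unique {γ δ : FreeHomotopyClass X} {g : FundamentalGroup X x}
    (hγ : γ.IsRepresentedBy g) (hδ : δ.IsRepresentedBy g) : γ = δ := by
  obtain ⟨p, c, hc, hp, rfl⟩ := hγ
  obtain ⟨q, d, hd, hq, rfl⟩ := hδ
  exact Quotient.sound
    (homotopic_of_path_homotopic (Path.Homotopic.Quotient.exact (hp.trans hq.symm)) hc hd)

theorem homotopic_comp_add (c : C(UnitAddCircle, X)) (a : ℝ) :
    c.Homotopic (c.comp ⟨fun θ => θ + (a : UnitAddCircle), by fun_prop⟩) := by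
  refine ⟨⟨c.comp ⟨fun z : I × UnitAddCircle => z.2 + ((z.1 * a : ℝ) : UnitAddCircle), ?_⟩,
    fun θ => ?_, fun θ => ?_⟩⟩
  · exact continuous_snd.add ((AddCircle.continuous_mk' 1).comp (by fun_prop))
  · simp
  · simp

/-- The two concatenations differ by a half turn of the circle, which is homotopic to the identity.
The product `g * h` runs along `h` first. -/
theorem IsRepresentedBy.eq_of_mul_comm {γ δ : FreeHomotopyClass X} {g h : FundamentalGroup X x}
    (hγ : γ.IsRepresentedBy (g * h)) (hδ : δ.IsRepresentedBy (h * g)) : γ = δ := by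
  obtain ⟨p, rfl⟩ := Path.Homotopic.Quotient.mk_surjective h
  obtain ⟨q, rfl⟩ := Path.Homotopic.Quotient.mk_surjective g
  obtain ⟨c, hc⟩ := exists_circleMap (p.trans q)
  rw [hγ.unique ⟨p.trans q, c, hc, rfl, rfl⟩]
  refine IsRepresentedBy.unique ⟨q.trans p, c.comp ⟨fun θ => θ + ((1 / 2 : ℝ) : UnitAddCircle),
    by fun_prop⟩, fun t => ?_, rfl, Quotient.sound (homotopic_comp_add c _).symm⟩ hδ
  simp only [ContinuousMap.comp_apply, ContinuousMap.coe_mk]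
  rw [← AddCircle.coe_add]
  rcases le_or_gt (t : ℝ) (1 / 2) with ht | ht
  · have ht' : (t : ℝ) + 1 / 2 ∈ I := ⟨by linarith [t.2.1], by linarith⟩
    rw [hc ⟨_, ht'⟩, Path.trans_apply, Path.trans_apply, dif_pos ht]
    split_ifs with h
    -- Only the junction of the two halves falls here, where both loops sit at the base point.
    · have h0 : (t : ℝ) = 0 := by simp only at h; linarith [t.2.1]
      rw [← Path.extend_apply, ← Path.extend_apply]
      simp [h0]
    · congr 1
      ext
      simp only
      ring
  · have ht' : (t : ℝ) - 1 / 2 ∈ I := ⟨by linarith, by linarith [t.2.2]⟩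
    have h1 : (((t : ℝ) + 1 / 2 : ℝ) : UnitAddCircle) = (((t : ℝ) - 1 / 2 : ℝ) : UnitAddCircle) := by
      rw [← AddCircle.coe_add_period (1 : ℝ) ((t : ℝ) - 1 / 2)]
      congr 1
      ring
    rw [h1, hc ⟨_, ht'⟩, Path.trans_apply, Path.trans_apply, dif_neg ht.not_ge,
      dif_pos (show (t : ℝ) - 1 / 2 ≤ 1 / 2 by linarith [t.2.2])]
    congr 1
    ext
    simp only
    ring

/-- Conjugate elements of the fundamental group represent the same free homotopy class. -/
theorem IsRepresentedBy.eq_of_isConj {γ δ : FreeHomotopyClass X} {g h : FundamentalGroup X x}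
    (hγ : γ.IsRepresentedBy g) (hδ : δ.IsRepresentedBy h) (hgh : IsConj g h) : γ = δ := by
  obtain ⟨k, rfl⟩ := isConj_iff.1 hgh
  have h : k⁻¹ * (k * g) = g := inv_mul_cancel_left k g
  exact IsRepresentedBy.eq_of_mul_comm (g := k⁻¹) (h := k * g) (h.symm ▸ hγ) hδ

/-- The path `r` is the track of the base point under the free homotopy. -/
theorem circleLoop_map_trans {c d : C(UnitAddCircle, X)} {y : X} (F : c.Homotopy d)
    {p : Path x x} {q : Path y y} (hc : ∀ t : I, c ((t : ℝ) : UnitAddCircle) = p t)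
    (hd : ∀ t : I, d ((t : ℝ) : UnitAddCircle) = q t) :
    ∃ r : Path x y, (p.trans r).Homotopic (r.trans q) := by
  have hx : x = c 0 := by simpa using (hc 0).symm
  have hy : y = d 0 := by simpa using (hd 0).symm
  refine ⟨(F.evalAt 0).cast hx hy, ?_⟩
  have h := (Path.Homotopic.map_trans_evalAt F circleLoop).pathCast hx hy
  have hp : p = (circleLoop.map c.continuous).cast hx hx := by ext t; exact (hc t).symm
  have hq : q = (circleLoop.map d.continuous).cast hy hy := by ext t; exact (hd t).symm
  rw [hp, hq]
  exact h

/-- Elements of the fundamental group representing the same free homotopy class are conjugate. -/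
theorem IsRepresentedBy.isConj {γ : FreeHomotopyClass X} {g h : FundamentalGroup X x}
    (hg : γ.IsRepresentedBy g) (hh : γ.IsRepresentedBy h) : IsConj g h := by
  obtain ⟨p, c, hc, rfl, rfl⟩ := hg
  obtain ⟨q, d, hd, rfl, he⟩ := hh
  obtain ⟨F⟩ : c.Homotopic d := (Quotient.exact he).symm
  obtain ⟨r, hr⟩ := circleLoop_map_trans F hc hd
  refine isConj_iff.2 ⟨(Path.Homotopic.Quotient.mk r : FundamentalGroup X x), ?_⟩
  rw [mul_inv_eq_iff_eq_mul]
  exact Path.Homotopic.Quotient.eq.2 hr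

/-- The path `t ↦ k t` in the real line. -/
noncomputable def linePath (k : ℕ) : Path (0 : ℝ) k where
  toFun t := k * t
  continuous_toFun := by fun_prop
  source' := by simp
  target' := by simp

theorem coe_natCast_unitAddCircle (k : ℕ) : ((k : ℝ) : UnitAddCircle) = 0 :=
  (AddCircle.coe_eq_zero_iff 1).2 ⟨k, by simp⟩

/-- The loop `t ↦ k t` in the circle. -/
noncomputable def circleLoopPow (k : ℕ) : Path (0 : UnitAddCircle) 0 :=
  ((linePath k).map (AddCircle.continuous_mk' 1)).cast (by simp)
    (coe_natCast_unitAddCircle k).symm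

theorem mk_circleLoopPow (k : ℕ) :
    FundamentalGroup.fromPath (Path.Homotopic.Quotient.mk (circleLoopPow k)) =
      FundamentalGroup.fromPath (Path.Homotopic.Quotient.mk circleLoop) ^ k := by
  induction k with
  | zero =>
    rw [pow_zero, FundamentalGroup.one_def, ← Path.Homotopic.Quotient.mk_refl]
    refine congrArg Path.Homotopic.Quotient.mk (Path.ext (funext fun t => ?_))
    change ((((0 : ℕ) : ℝ) * t : ℝ) : UnitAddCircle) = 0
    simp
  | succ k ih =>
    rw [pow_succ', ← ih, FundamentalGroup.mul_def]
    -- In the simply connected line, the path to `k + 1` is homotopic to the path to `k` followed by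
    -- a unit segment, which projects to `circleLoop`.
    let s : Path (k : ℝ) (k + 1 : ℕ) :=
      { toFun := fun t => k + t
        continuous_toFun := by fun_prop
        source' := by simp
        target' := by simp }
    have h := ((SimplyConnectedSpace.paths_homotopic (linePath (k + 1)) ((linePath k).trans s)).map
      ⟨_, AddCircle.continuous_mk' 1⟩).pathCast (x₂ := 0) (x₃ := 0) (by simp)
      (coe_natCast_unitAddCircle (k + 1)).symm
    refine Path.Homotopic.Quotient.eq.2 (h.trans ?_)
    rw [Path.map_trans]
    have hs : circleLoop = (s.map (AddCircle.continuous_mk' 1)).cast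
        (coe_natCast_unitAddCircle k).symm (coe_natCast_unitAddCircle (k + 1)).symm := by
      ext t
      change ((t : ℝ) : UnitAddCircle) = ((k + t : ℝ) : UnitAddCircle)
      rw [AddCircle.coe_add, coe_natCast_unitAddCircle, zero_add]
    rw [hs]
    exact .refl _

/-- An element representing a proper power of a free homotopy class is a proper power. -/
theorem IsRepresentedBy.exists_eq_pow {δ : FreeHomotopyClass X} {k : ℕ}
    {g : FundamentalGroup X x} (h : (δ.pow k).IsRepresentedBy g) : ∃ f, g = f ^ k := by
  obtain ⟨p, c, hc, rfl, he⟩ := h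
  obtain ⟨d, rfl⟩ := Quotient.exists_rep δ
  obtain ⟨F⟩ : c.Homotopic (d.comp (circlePow k)) := Quotient.exact he
  obtain ⟨r, hr⟩ := circleLoop_map_trans F hc (q := (circleLoopPow k).map d.continuous) (by
    intro t
    change d (k • ((t : ℝ) : UnitAddCircle)) = d ((k * t : ℝ) : UnitAddCircle)
    rw [← AddCircle.coe_nsmul, nsmul_eq_mul])
  -- Transport along `r` identifies the given element with the image under `d` of the `k`-th power
  -- of `circleLoop`; the transport and `d` both respect powers.
  let φ := FundamentalGroup.fundamentalGroupMulEquivOfPath r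
  let m := FundamentalGroup.map d 0
  refine ⟨φ.symm (m (FundamentalGroup.fromPath (Path.Homotopic.Quotient.mk circleLoop))), ?_⟩
  rw [← map_pow, ← map_pow, ← mk_circleLoopPow, MulEquiv.eq_symm_apply]
  have h : FundamentalGroupoid.fromPath (.mk p) ≫ FundamentalGroupoid.fromPath (.mk r) =
      FundamentalGroupoid.fromPath (.mk r) ≫
        FundamentalGroupoid.fromPath (.mk ((circleLoopPow k).map d.continuous)) :=
    Path.Homotopic.Quotient.eq.2 hr
  exact (CategoryTheory.Iso.inv_comp_eq ((CategoryTheory.Groupoid.isoEquivHom _ _).symm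
    (FundamentalGroupoid.fromPath (.mk r)))).2 h

end FreeHomotopyClass

/-! ### Asymptotics of the sequence and of its partial sums -/

open Asymptotics Topology

theorem isEquivalent_three_pow_div {a : ℕ → ℕ}
    (h : ∀ L : ℕ, 0 < L → |(L : ℝ) * a L - 3 ^ L| ≤ 3 + L * (L * 2 ^ L)) :
    (fun L : ℕ => (a L : ℝ)) ~[atTop] fun L : ℕ => (3 : ℝ) ^ L / L := by
  have h1 : Tendsto (fun L : ℕ => 3 * (1 / 3 : ℝ) ^ L + (L : ℝ) ^ 2 * (2 / 3 : ℝ) ^ L) atTop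
      (𝓝 0) := by
    simpa using ((tendsto_pow_atTop_nhds_zero_of_lt_one (r := (1 / 3 : ℝ)) (by norm_num)
      (by norm_num)).const_mul 3).add (tendsto_pow_const_mul_const_pow_of_abs_lt_one 2
        (r := (2 / 3 : ℝ)) (by rw [abs_of_pos] <;> norm_num))
  refine isEquivalent_of_tendsto_one (tendsto_iff_norm_sub_tendsto_zero.2
    (squeeze_zero' (Eventually.of_forall fun _ => norm_nonneg _) ?_ h1))
  filter_upwards [eventually_gt_atTop 0] with L hL
  have hL' : (L : ℝ) ≠ 0 := by positivity
  have h3 : (0 : ℝ) < 3 ^ L := by positivity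
  have he : ((fun L : ℕ => (a L : ℝ)) / fun L : ℕ => (3 : ℝ) ^ L / L) L - 1 =
      (L * a L - 3 ^ L) / 3 ^ L := by
    rw [Pi.div_apply]
    field_simp
  rw [he, Real.norm_eq_abs, abs_div, abs_of_pos h3, div_le_iff₀ h3]
  refine (h L hL).trans_eq ?_
  rw [add_mul, mul_assoc, ← mul_pow, mul_assoc ((L : ℝ) ^ 2), ← mul_pow]
  norm_num
  ring

theorem tendsto_three_pow_div_atTop : Tendsto (fun L : ℕ => (3 : ℝ) ^ L / L) atTop atTop := by
  have h := tendsto_pow_const_div_const_pow_of_one_lt 1 (r := (3 : ℝ)) (by norm_num)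
  have h2 : Tendsto (fun L : ℕ => (L : ℝ) ^ 1 / 3 ^ L) atTop (𝓝[>] 0) :=
    tendsto_nhdsWithin_iff.2 ⟨h, by
      filter_upwards [eventually_gt_atTop 0] with L hL
      exact Set.mem_Ioi.2 (by positivity)⟩
  refine h2.inv_tendsto_nhdsGT_zero.congr fun L => ?_
  rw [Pi.inv_apply, inv_div, pow_one]

/-- A sequence asymptotic to `3 ^ L / L` has partial sums asymptotic to `3 / 2 * (3 ^ L / L)`. -/
theorem isEquivalent_sum_three_pow_div {a : ℕ → ℝ}
    (h : a ~[atTop] fun L : ℕ => (3 : ℝ) ^ L / L) :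
    (fun L : ℕ => ∑ n ∈ Finset.range (L + 1), a n) ~[atTop]
      fun L : ℕ => (3 / 2 : ℝ) * ((3 : ℝ) ^ L / L) := by
  -- The differences `g` of the target telescope and are equivalent to `3 ^ n / n`; since they are
  -- nonnegative with divergent sum, equivalence passes to partial sums. Both `G 0` and `g 0`
  -- vanish, by division by zero and truncated subtraction.
  set G : ℕ → ℝ := fun L => (3 / 2 : ℝ) * ((3 : ℝ) ^ L / L) with hG
  set g : ℕ → ℝ := fun n => G n - G (n - 1) with hg
  have hsum : ∀ L, ∑ n ∈ Finset.range (L + 1), g n = G L := fun L => by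
    rw [Finset.sum_range_succ']
    simp only [hg, Nat.add_sub_cancel, Finset.sum_range_sub]
    simp [hG]
  have hgn : ∀ n : ℕ, g (n + 2) =
      3 ^ (n + 2) / ((n + 2 : ℕ) : ℝ) * (1 - 1 / ((n + 1 : ℕ) : ℝ) / 2) := fun n => by
    simp only [hg, hG, Nat.add_succ_sub_one]
    push_cast
    field_simp
    ring
  have hpos : ∀ n, 0 ≤ g n
    | 0 => by simp [hg]
    | 1 => by norm_num [hg, hG]
    | n + 2 => by
      rw [hgn]
      have h1 : 1 / ((n + 1 : ℕ) : ℝ) ≤ 1 := by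
        rw [div_le_one (by positivity)]
        exact_mod_cast Nat.succ_pos n
      exact mul_nonneg (by positivity) (by linarith)
  have hlim : Tendsto (fun n : ℕ => g n / (3 ^ n / n)) atTop (𝓝 1) := by
    rw [← tendsto_add_atTop_iff_nat 2]
    have h1 : Tendsto (fun n : ℕ => (1 : ℝ) - 1 / ((n + 1 : ℕ) : ℝ) / 2) atTop (𝓝 1) := by
      have := ((tendsto_one_div_add_atTop_nhds_zero_nat (𝕜 := ℝ)).div_const 2).const_sub 1
      simpa using this
    refine h1.congr fun n => ?_
    rw [hgn, mul_div_cancel_left₀]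
    positivity
  have hag : a ~[atTop] g := h.trans (isEquivalent_of_tendsto_one hlim).symm
  have hGtop : Tendsto G atTop atTop :=
    tendsto_three_pow_div_atTop.const_mul_atTop (by norm_num)
  have htop : Tendsto (fun n => ∑ i ∈ Finset.range n, g i) atTop atTop := by
    rw [← tendsto_add_atTop_iff_nat 1]
    simpa only [hsum] using hGtop
  have hlo := (hag.isLittleO.sum_range hpos htop).comp_tendsto (tendsto_add_atTop_nat 1)
  refine hlo.congr (fun L => ?_) (fun L => ?_)
  · simp [Function.comp, Finset.sum_sub_distrib, hsum]
  · simp [Function.comp, hsum]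

theorem FreeGroupBasis.repr_symm_mk {ι G : Type*} [Group G] (B : FreeGroupBasis ι G)
    (w : List (ι × Bool)) :
    (w.map fun l => if l.2 then B l.1 else (B l.1)⁻¹).prod = B.repr.symm (FreeGroup.mk w) := by
  induction w with
  | nil => simp [← FreeGroup.one_eq_mk]
  | cons a l ih =>
    rw [FreeGroup.mk_cons, map_mul, ← ih, List.map_cons, List.prod_cons]
    congr 1
    rcases a with ⟨i, _ | _⟩
    · have := FreeGroup.mk_singleton_not (i, true)
      simp only [Bool.not_true] at this
      rw [this, map_inv]
      rfl
    · rfl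

theorem Set.ncard_image_eq_ncard_image {α β γ : Type*} [Nonempty α] {s : Set α} {f : α → β}
    {g : α → γ} (h : ∀ a ∈ s, ∀ b ∈ s, f a = f b ↔ g a = g b) :
    (f '' s).ncard = (g '' s).ncard := by
  have hmem : ∀ y ∈ g '' s, Function.invFunOn g s y ∈ s := fun y hy =>
    Function.invFunOn_mem hy
  have heq : ∀ y ∈ g '' s, g (Function.invFunOn g s y) = y := fun y hy =>
    Function.invFunOn_eq hy
  have himg : f '' s = (f ∘ Function.invFunOn g s) '' (g '' s) := by
    rw [Set.image_image]
    refine Set.image_congr fun a ha => ?_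
    have ha' := Set.mem_image_of_mem g ha
    exact (h _ ha _ (hmem _ ha')).2 (heq _ ha').symm
  rw [himg]
  refine Set.InjOn.ncard_image ?_
  intro y hy z hz hyz
  rw [← heq y hy, ← heq z hz]
  exact (h _ (hmem y hy) _ (hmem z hz)).1 hyz

/-! ### Counting curves by word length -/

namespace FreeHomotopyClass

open FreeGroup

variable {X : Type*} [TopologicalSpace X] {x : X}
  (B : FreeGroupBasis (Fin 2) (FundamentalGroup X x))

/-- The free homotopy class represented by a word. -/
noncomputable def ofWord (w : List (Fin 2 × Bool)) : FreeHomotopyClass X :=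
  (exists_isRepresentedBy (B.repr.symm (FreeGroup.mk w))).choose

theorem ofWord_isRepresentedBy (w : List (Fin 2 × Bool)) :
    (ofWord B w).IsRepresentedBy (B.repr.symm (FreeGroup.mk w)) :=
  (exists_isRepresentedBy (B.repr.symm (FreeGroup.mk w))).choose_spec

theorem ofWord_eq_ofWord_iff {v w : List (Fin 2 × Bool)} (hv : IsCyclicallyReduced v)
    (hw : IsCyclicallyReduced w) : ofWord B v = ofWord B w ↔ v ~r w := by
  constructor
  · intro h
    have hc := (ofWord_isRepresentedBy B w).isConj (h ▸ ofWord_isRepresentedBy B v)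
    refine hv.isRotated_of_isConj hw ?_
    simpa using B.repr.toMonoidHom.map_isConj hc
  · rintro ⟨n, rfl⟩
    refine (ofWord_isRepresentedBy B v).eq_of_isConj (ofWord_isRepresentedBy B _) ?_
    refine B.repr.symm.toMonoidHom.map_isConj ?_
    rw [← List.rotate_mod, List.rotate_eq_drop_append_take_mod, Nat.mod_mod]
    nth_rw 1 [← List.take_append_drop (n % v.length) v]
    rw [← mul_mk, ← mul_mk]
    exact isConj_iff.2 ⟨(FreeGroup.mk (v.take (n % v.length)))⁻¹, by group⟩

theorem setOf_hasWordLength (L : ℕ) :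
    {γ : FreeHomotopyClass X | γ.HasWordLength B L} = ofWord B '' (cycWords L : Set _) := by
  ext γ
  simp only [Set.mem_ofPred_eq, Set.mem_image, HasWordLength, B.repr_symm_mk, Finset.mem_coe,
    mem_cycWords]
  constructor
  · rintro ⟨w, h1, h2, h3⟩
    exact ⟨w, ⟨h2, h1⟩, (ofWord_isRepresentedBy B w).unique h3⟩
  · rintro ⟨w, ⟨h2, h1⟩, rfl⟩
    exact ⟨w, h1, h2, ofWord_isRepresentedBy B w⟩

theorem finite_setOf_hasWordLength (L : ℕ) :
    {γ : FreeHomotopyClass X | γ.HasWordLength B L}.Finite := by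
  rw [setOf_hasWordLength]
  exact (cycWords L).finite_toSet.image _

theorem ncard_setOf_hasWordLength (L : ℕ) :
    {γ : FreeHomotopyClass X | γ.HasWordLength B L}.ncard = (cycClasses L).card := by
  rw [setOf_hasWordLength, Set.ncard_image_eq_ncard_image (g := Cycle.ofList), cycClasses,
    ← Set.ncard_coe_finset, Finset.coe_image]
  intro v hv w hw
  rw [ofWord_eq_ofWord_iff B (mem_cycWords.1 hv).2 (mem_cycWords.1 hw).2]
  exact Cycle.coe_eq_coe.symm

variable {B} in
theorem HasWordLength.unique {γ : FreeHomotopyClass X} {m n : ℕ} (hm : γ.HasWordLength B m)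
    (hn : γ.HasWordLength B n) : m = n := by
  have hm' := (setOf_hasWordLength B m).subset hm
  have hn' := (setOf_hasWordLength B n).subset hn
  obtain ⟨v, hv, rfl⟩ := hm'
  obtain ⟨w, hw, h⟩ := hn'
  obtain ⟨rfl, hv'⟩ := mem_cycWords.1 hv
  obtain ⟨rfl, hw'⟩ := mem_cycWords.1 hw
  exact ((ofWord_eq_ofWord_iff B hw' hv').1 h).perm.length_eq.symm

/-- Word length is unique, so the spheres are disjoint. The predicate `P` serves both the primitive
and the unrestricted count. -/
theorem ncard_setOf_exists_hasWordLength (P : FreeHomotopyClass X → Prop) (L : ℕ) :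
    {γ : FreeHomotopyClass X | P γ ∧ ∃ n ≤ L, γ.HasWordLength B n}.ncard =
      ∑ n ∈ Finset.range (L + 1), {γ : FreeHomotopyClass X | P γ ∧ γ.HasWordLength B n}.ncard := by
  have hfin : ∀ n, {γ : FreeHomotopyClass X | P γ ∧ γ.HasWordLength B n}.Finite := fun n =>
    (finite_setOf_hasWordLength B n).subset fun γ h => h.2
  induction L with
  | zero => simp
  | succ L ih =>
    have hset : {γ : FreeHomotopyClass X | P γ ∧ ∃ n ≤ L + 1, γ.HasWordLength B n} =
        {γ | P γ ∧ ∃ n ≤ L, γ.HasWordLength B n} ∪ {γ | P γ ∧ γ.HasWordLength B (L + 1)} := by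
      ext γ
      simp only [Set.mem_ofPred_eq, Set.mem_union, Nat.le_succ_iff, or_and_right, exists_or,
        exists_eq_left, and_or_left]
    have hfin' : {γ : FreeHomotopyClass X | P γ ∧ ∃ n ≤ L, γ.HasWordLength B n}.Finite := by
      refine ((Set.finite_le_nat L).biUnion fun n _ => hfin n).subset ?_
      rintro γ ⟨h1, n, hn, h2⟩
      exact Set.mem_biUnion hn ⟨h1, h2⟩
    rw [hset, Set.ncard_union_eq ?_ hfin' (hfin _), ih, ← Finset.sum_range_succ]
    refine Set.disjoint_left.2 ?_
    rintro γ ⟨-, n, hn, h1⟩ ⟨-, h2⟩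
    exact absurd (h1.unique h2) (by omega)

theorem ncard_setOf_not_isPrimitive_le {L : ℕ} (hL : 0 < L) :
    ({γ : FreeHomotopyClass X | γ.HasWordLength B L} \
      {γ | γ.IsPrimitive ∧ γ.HasWordLength B L}).ncard ≤ (periodicWords L).card := by
  refine (Set.ncard_le_ncard ?_ ((periodicWords L).finite_toSet.image (ofWord B))).trans
    ((Set.ncard_image_le (periodicWords L).finite_toSet).trans (Set.ncard_coe_finset _).le)
  rintro γ ⟨hγ, hprim⟩
  obtain ⟨δ, k, hk, hδ⟩ : ∃ (δ : FreeHomotopyClass X) (k : ℕ), 2 ≤ k ∧ γ = δ.pow k := by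
    by_contra h
    exact hprim ⟨h, hγ⟩
  obtain ⟨w, hw, rfl⟩ := (setOf_hasWordLength B L).subset hγ
  refine ⟨w, mem_periodicWords.2 ⟨hw, ?_⟩, rfl⟩
  obtain ⟨rfl, hw'⟩ := mem_cycWords.1 hw
  obtain ⟨f, hf⟩ := (hδ ▸ ofWord_isRepresentedBy B w : (δ.pow k).IsRepresentedBy _).exists_eq_pow
  obtain ⟨m, h1, h2, h3⟩ := hw'.exists_rotate_eq (g := B.repr f) (List.length_pos_iff.1 hL) hk (by
    rw [← map_pow, ← hf, MulEquiv.apply_symm_apply])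
  exact ⟨m, Finset.mem_Icc.2 ⟨h1, by omega⟩, h3⟩

/-- Any set between the primitive curves and all curves of length `L` misses at most as many curves
as there are periodic words, so one estimate covers both counts. -/
theorem abs_mul_ncard_sub_le {L : ℕ} (hL : 0 < L) {s : Set (FreeHomotopyClass X)}
    (hs : {γ | γ.IsPrimitive ∧ γ.HasWordLength B L} ⊆ s)
    (hs' : s ⊆ {γ | γ.HasWordLength B L}) :
    |(L : ℝ) * s.ncard - 3 ^ L| ≤ 3 + L * (L * 2 ^ L) := by
  have hfin := finite_setOf_hasWordLength B L
  have h1 : s.ncard ≤ (cycClasses L).card :=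
    (Set.ncard_le_ncard hs' hfin).trans_eq (ncard_setOf_hasWordLength B L)
  have h2 : (cycClasses L).card ≤ s.ncard + (periodicWords L).card := by
    rw [← ncard_setOf_hasWordLength B L,
      ← Set.ncard_sdiff_add_ncard_of_subset (hs.trans hs') hfin, add_comm]
    exact add_le_add (Set.ncard_le_ncard hs (hfin.subset hs'))
      (ncard_setOf_not_isPrimitive_le B hL)
  have h3 := card_periodicWords_le L
  have h4 : L * s.ncard ≤ (cycWords L).card + L * (L * 2 ^ L) :=
    (Nat.mul_le_mul_left L h1).trans ((mul_card_cycClasses_le L).trans (by gcongr))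
  have h5 : (cycWords L).card ≤ L * s.ncard + L * (L * 2 ^ L) := by
    rw [← mul_add]
    exact (card_cycWords_le hL).trans (Nat.mul_le_mul_left L (h2.trans (by gcongr)))
  have h4' : (L : ℝ) * s.ncard ≤ (cycWords L).card + L * (L * 2 ^ L) := by exact_mod_cast h4
  have h5' : ((cycWords L).card : ℝ) ≤ L * s.ncard + L * (L * 2 ^ L) := by exact_mod_cast h5
  have h6 := abs_le.1 (abs_card_cycWords_sub_le hL)
  exact abs_le.2 ⟨by linarith, by linarith⟩

end FreeHomotopyClass

theorem mainTheorem11 (x : OncePuncturedTorus)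
    (B : FreeGroupBasis (Fin 2) (FundamentalGroup OncePuncturedTorus x)) :
    Asymptotics.IsEquivalent atTop
      (fun L : ℕ => (({γ : FreeHomotopyClass OncePuncturedTorus |
        γ.IsPrimitive ∧ γ.HasWordLength B L}.ncard : ℕ) : ℝ))
      (fun L : ℕ => (3 : ℝ) ^ L / (L : ℝ)) ∧
    Asymptotics.IsEquivalent atTop
      (fun L : ℕ => (({γ : FreeHomotopyClass OncePuncturedTorus |
        γ.IsPrimitive ∧ ∃ n ≤ L, γ.HasWordLength B n}.ncard : ℕ) : ℝ))
      (fun L : ℕ => (3 / 2 : ℝ) * ((3 : ℝ) ^ L / (L : ℝ))) ∧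
    Asymptotics.IsEquivalent atTop
      (fun L : ℕ => (({γ : FreeHomotopyClass OncePuncturedTorus |
        γ.HasWordLength B L}.ncard : ℕ) : ℝ))
      (fun L : ℕ => (3 : ℝ) ^ L / (L : ℝ)) ∧
    Asymptotics.IsEquivalent atTop
      (fun L : ℕ => (({γ : FreeHomotopyClass OncePuncturedTorus |
        ∃ n ≤ L, γ.HasWordLength B n}.ncard : ℕ) : ℝ))
      (fun L : ℕ => (3 / 2 : ℝ) * ((3 : ℝ) ^ L / (L : ℝ))) := by
  have hprim := isEquivalent_three_pow_div fun L hL =>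
    FreeHomotopyClass.abs_mul_ncard_sub_le B hL (s := {γ | γ.IsPrimitive ∧ γ.HasWordLength B L})
      subset_rfl fun _ h => h.2
  have hall := isEquivalent_three_pow_div fun L hL =>
    FreeHomotopyClass.abs_mul_ncard_sub_le B hL (s := {γ | γ.HasWordLength B L})
      (fun _ h => h.2) subset_rfl
  refine ⟨hprim, ?_, hall, ?_⟩
  · simpa only [FreeHomotopyClass.ncard_setOf_exists_hasWordLength, Nat.cast_sum] using
      isEquivalent_sum_three_pow_div hprim
  · have h := FreeHomotopyClass.ncard_setOf_exists_hasWordLength B fun _ => True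
    simp only [true_and] at h
    simpa only [h, Nat.cast_sum] using isEquivalent_sum_three_pow_div hall
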